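/- Consider a bufferless (queueless) single server with service preemption and push-out: messages $n\in\mathbb Z$ arrive at times $\cdots<T_{-1}<T_0\le 0<T_1<\cdots$, message $n$ enters service immediately at time $T_n$, pushing out any message still in service, and it departs successfully at time $T_n+S_n$ if and only if its service time $S_n$ is smaller than $T_{n+1}-T_n$; otherwise it is lost. Let $A(t)$ be the largest arrival time $\le t$, let $D(t)$ be the largest (successful) departure time $\le t$, let $\tilde A(t)$ be the largest arrival time among the messages that have successfully departed by time $t$, and let $$\Delta(t)=A(t)-\tilde A(D(t))$$ be the relative age of information (AoI). Let the server be in its stationary regime: the arrivals form a stationary renewal process on $\mathbb R$ with interarrival law $F$ (that is, the interarrival interval containing time $0$ and the age $a=-T_0$ have joint law $F(\mathrm dx)\,\mathbf 1\{0\le a<x\}\,\mathrm da/\int y\,F(\mathrm dy)$, and the other interarrival times are i.i.d. with law $F$ and independent of this pair), and the service times are i.i.d. and independent of the arrivals. Let $\beta,\delta>0$ and let the service times be exponential with rate $\delta$. If $F$ is the exponential law with rate $\beta$ (the M/M/1/1-PO server), then $\Delta$ is a stationary process, $\Delta(t)$ is integrable for every $t\in\mathbb R$, and the stationary average relative AoI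 is $$\overline\Delta=\mathsf E\,\Delta(t)=\frac1\delta\qquad\text{for every }t\in\mathbb R.$$ The same holds, with the same value $\overline\Delta=1/\delta$, when the interarrival times are deterministic, equal to $1/\beta$ (the D/M/1/1-PO server). -/

import Mathlib

open MeasureTheory ProbabilityTheory

noncomputable section

namespace PushOut

/-! ### One sample path of the bufferless preemptive push-out server

`T n` is the arrival time of message `n` and `S n` its service requirement (`n : ℤ`).
Service of message `n` starts at once at time `T n`, pushing out whatever is in service. -/

/-- Message `n` is transmitted successfully: its service ends before the next arrival,
which would push it out. It then departs at time `T n + S n`. -/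
def Succeeds (T S : ℤ → ℝ) (n : ℤ) : Prop := S n < T (n + 1) - T n

/-- `A(t)`: the largest arrival time that is `≤ t`. -/
def lastArrival (T : ℤ → ℝ) (t : ℝ) : ℝ := sSup {a | ∃ n : ℤ, a = T n ∧ a ≤ t}

/-- `D(t)`: the largest departure time that is `≤ t`. -/
def lastDeparture (T S : ℤ → ℝ) (t : ℝ) : ℝ :=
  sSup {d | ∃ n : ℤ, Succeeds T S n ∧ d = T n + S n ∧ d ≤ t}

/-- `Ã(t)`: the largest arrival time among the messages that have successfully departed
by time `t`. -/
def lastDepartedArrival (T S : ℤ → ℝ) (t : ℝ) : ℝ :=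
  sSup {a | ∃ n : ℤ, Succeeds T S n ∧ T n + S n ≤ t ∧ a = T n}

/-- The relative age of information `Δ(t) = A(t) - Ã(D(t))`. -/
def relAoI (T S : ℤ → ℝ) (t : ℝ) : ℝ :=
  lastArrival T t - lastDepartedArrival T S (lastDeparture T S t)

/-! ### The server in its stationary regime on the whole time axis -/

/-- A sample point: `ω.1.1` is the length of the interarrival interval `[T 0, T 1)` that contains
time `0`, `ω.1.2` the age `0 - T 0` of the arrival process at time `0`, `ω.2.1` the list of the
other interarrival times, and `ω.2.2` the list of the service times. -/
abbrev Sample : Type := (ℝ × ℝ) × ({n : ℤ // n ≠ 0} → ℝ) × (ℤ → ℝ)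

/-- The interarrival time `T (n + 1) - T n`. -/
def gap (ω : Sample) (n : ℤ) : ℝ := if h : n = 0 then ω.1.1 else ω.2.1 ⟨n, h⟩

/-- The arrival times `⋯ < T (-1) < T 0 ≤ 0 < T 1 < ⋯`. -/
def arrival (ω : Sample) (n : ℤ) : ℝ :=
  -ω.1.2 + ∑ k ∈ Finset.Ico 0 n, gap ω k - ∑ k ∈ Finset.Ico n 0, gap ω k

/-- The service times. -/
def service (ω : Sample) (n : ℤ) : ℝ := ω.2.2 n

/-- The law, in a stationary renewal process with interarrival law `F`, of the pair (length of the
interval that contains time `0`, age at time `0`), namely `F(dx) 1{0 ≤ a < x} da / E X`: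
the length is size-biased and, given the length, the age is uniform. -/
def inspectionLaw (F : Measure ℝ) : Measure (ℝ × ℝ) :=
  (∫⁻ x, ENNReal.ofReal x ∂F)⁻¹ • (F.prod volume).restrict {p | 0 ≤ p.2 ∧ p.2 < p.1}

/-- The stationary regime of the GI/GI/1/1-PO server with interarrival law `F` and service law
`G`: arrivals form the stationary renewal process on `ℝ` with interarrival law `F`, service times
are i.i.d. with law `G`, and the two are independent. -/
def stationaryLaw (F G : Measure ℝ) : Measure Sample :=
  (inspectionLaw F).prod
    ((Measure.infinitePi fun _ : {n : ℤ // n ≠ 0} => F).prod (Measure.infinitePi fun _ : ℤ => G))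

/-- The process `Δ(t)` of the server. -/
def Delta (ω : Sample) (t : ℝ) : ℝ := relAoI (arrival ω) (service ω) t

/-- The GI/GI/1/1-PO server with interarrival law `F` and service law `G` has stationary average
relative age of information `m`: its regime is a probability law under which `Δ` is a strictly
stationary process, and `Δ(t)` has finite expectation `m` at every time `t`. -/
structure HasStationaryAverage (F G : Measure ℝ) (m : ℝ) : Prop where
  isProbability : IsProbabilityMeasure (stationaryLaw F G)
  stationary : ∀ s : ℝ, IdentDistrib (fun ω (t : ℝ) => Delta ω (s + t)) (fun ω t => Delta ω t)
    (stationaryLaw F G) (stationaryLaw F G)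
  integrable : ∀ t : ℝ, Integrable (fun ω => Delta ω t) (stationaryLaw F G)
  mean_eq : ∀ t : ℝ, ∫ ω, Delta ω t ∂(stationaryLaw F G) = m

end PushOut

end

open MeasureTheory ProbabilityTheory

namespace PushOut

/-! Mean. At time `0`, the relative age is the sum over `k ≥ 0` of the interarrival lengths `X
(-(k+1))`, each counted when message `0` is still in service and messages `-1, …, -k` were all
pushed out (`IsRegularPath.ofReal_relAoI_zero`). By independence the `k`-th term has mean `P(S > a)
· E X · q ^ k`, where `a` is the stationary age and `q = P(S ≥ X)`. The factor `E X` cancels the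
normalisation of the law of `a`, and the geometric series gives `E ∫_0^X P(S > a) da / P(S < X)`
(`lintegral_Delta_zero`). For exponential service the density is `δ` times the tail, so the
numerator is `P(S < X) / δ` and the quotient is `1 / δ`, whatever `F` is.

Stationarity. On triples (gaps, services, age) with law `F^ℤ ⊗ G^ℤ ⊗ Lebesgue`, renumbering the
messages is a measure-preserving action of `ℤ` that does not change the relative age process, while
adding `s` to the age preserves the measure and moves time by `s`. The stationary law is the
normalised restriction to `domain 0`; the translation carries it to `domain s`, and both are
fundamental domains of the action, so invariant events have equal measure in them
(`Suspension.identDistrib_age`). -/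

/-! ### Sample paths -/

/-- A path with increasing arrival times that are unbounded in both directions, nonnegative
service times, and infinitely many successful messages in the past. -/
structure IsRegularPath (T S : ℤ → ℝ) : Prop where
  strictMono : StrictMono T
  service_nonneg : ∀ n, 0 ≤ S n
  exists_arrival_le : ∀ t, ∃ n, T n ≤ t
  exists_lt_arrival : ∀ t, ∃ n, t < T n
  exists_succeeds_le : ∀ m, ∃ n ≤ m, Succeeds T S n

/-- At time `t`, message `N` is the last one to have arrived and message `M` is the last one to
have departed. -/
structure IsStateAt (T S : ℤ → ℝ) (t : ℝ) (N M : ℤ) : Prop where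
  arrival_le : T N ≤ t
  lt_arrival : t < T (N + 1)
  succeeds : Succeeds T S M
  departure_le : T M + S M ≤ t
  lt_departure : ∀ m, M < m → Succeeds T S m → t < T m + S m

variable {T S : ℤ → ℝ} {t : ℝ} {N M : ℤ}

/-- Hence successful messages depart in the order of their arrival, so the last departure belongs to
the latest message that has departed. -/
lemma Succeeds.departure_lt_arrival {m n : ℤ} (h : Succeeds T S m) (hT : Monotone T)
    (hmn : m < n) : T m + S m < T n := by
  have h1 : T (m + 1) ≤ T n := hT (by omega)
  unfold Succeeds at h
  linarith

lemma IsStateAt.le_of_departed {m : ℤ} (h : IsStateAt T S t N M) (hm : Succeeds T S m)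
    (hmt : T m + S m ≤ t) : m ≤ M := by
  by_contra! hlt
  exact (h.lt_departure m hlt hm).not_ge hmt

/-- The relative age is the difference of the arrival times of the last message to arrive and of
the last message to depart. -/
lemma IsStateAt.relAoI_eq (h : IsStateAt T S t N M) (hT : Monotone T) (hS : ∀ n, 0 ≤ S n) :
    relAoI T S t = T N - T M := by
  have hA : lastArrival T t = T N := by
    refine IsGreatest.csSup_eq ⟨⟨N, rfl, h.arrival_le⟩, ?_⟩
    rintro _ ⟨n, rfl, hn⟩
    refine hT ?_
    by_contra! hlt
    have : T (N + 1) ≤ T n := hT (by omega)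
    linarith [h.lt_arrival]
  have hD : lastDeparture T S t = T M + S M := by
    refine IsGreatest.csSup_eq ⟨⟨M, h.succeeds, rfl, h.departure_le⟩, ?_⟩
    rintro _ ⟨n, hn, rfl, hnt⟩
    rcases (h.le_of_departed hn hnt).eq_or_lt with rfl | hlt
    · exact le_rfl
    · linarith [hn.departure_lt_arrival hT hlt, hS M]
  have hL : lastDepartedArrival T S (T M + S M) = T M := by
    refine IsGreatest.csSup_eq ⟨⟨M, h.succeeds, le_rfl, rfl⟩, ?_⟩
    rintro _ ⟨n, hn, hnt, rfl⟩
    exact hT (h.le_of_departed hn (hnt.trans h.departure_le))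
  rw [relAoI, hA, hD, hL]

/-- On a regular path all the suprema in the model are therefore attained, so the default value of
`sSup` plays no role. -/
lemma IsRegularPath.exists_isStateAt (h : IsRegularPath T S) (t : ℝ) :
    ∃ N M, IsStateAt T S t N M := by
  obtain ⟨b, hb⟩ := h.exists_lt_arrival t
  have hbd : ∀ n, T n ≤ t → n ≤ b := fun n hn => (h.strictMono.lt_iff_lt.1 (hn.trans_lt hb)).le
  obtain ⟨N, hN, hN'⟩ := Int.exists_greatest_of_bdd (P := fun n => T n ≤ t) ⟨b, hbd⟩
    (h.exists_arrival_le t)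
  -- A success strictly before message `N` departs before `T N ≤ t`, so some message has departed by
  -- time `t`.
  obtain ⟨m, hmN, hm⟩ := h.exists_succeeds_le (N - 1)
  obtain ⟨M, ⟨hM, hMt⟩, hM'⟩ := Int.exists_greatest_of_bdd
    (P := fun n => Succeeds T S n ∧ T n + S n ≤ t)
    ⟨b, fun n hn => hbd n (by linarith [hn.2, h.service_nonneg n])⟩
    ⟨m, hm, (hm.departure_lt_arrival h.strictMono.monotone (by omega : m < N)).le.trans hN⟩
  refine ⟨N, M, hN, ?_, hM, hMt, fun k hk hks => ?_⟩
  · by_contra! hle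
    have := hN' _ hle
    omega
  · by_contra! hle
    have := hM' _ ⟨hks, hle⟩
    omega

lemma relAoI_comp_add_right (T S : ℤ → ℝ) (k : ℤ) :
    relAoI (fun n => T (n + k)) (fun n => S (n + k)) = relAoI T S := by
  have hex (p : ℤ → Prop) : (∃ n, p (n + k)) ↔ ∃ n, p n :=
    (Equiv.addRight k).surjective.exists.symm
  have hA : lastArrival (fun n => T (n + k)) = lastArrival T := by
    funext t
    exact congrArg sSup (Set.ext fun a => hex fun n => a = T n ∧ a ≤ t)
  have hs (n : ℤ) : Succeeds (fun n => T (n + k)) (fun n => S (n + k)) n ↔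
      Succeeds T S (n + k) := by
    simp only [Succeeds, add_right_comm]
  have hD : lastDeparture (fun n => T (n + k)) (fun n => S (n + k)) = lastDeparture T S := by
    funext t
    simp only [lastDeparture, hs]
    exact congrArg sSup (Set.ext fun d => hex fun n => Succeeds T S n ∧ d = T n + S n ∧ d ≤ t)
  have hL : lastDepartedArrival (fun n => T (n + k)) (fun n => S (n + k)) =
      lastDepartedArrival T S := by
    funext t
    simp only [lastDepartedArrival, hs]
    exact congrArg sSup
      (Set.ext fun a => hex fun n => Succeeds T S n ∧ T n + S n ≤ t ∧ a = T n)
  funext t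
  rw [relAoI, relAoI, hA, hD, hL]

/-- Regularity is used because `sSup` of an empty or unbounded set is `0`, which does not move with
the origin of time. -/
lemma IsRegularPath.relAoI_sub (h : IsRegularPath T S) (c t : ℝ) :
    relAoI (fun n => T n - c) S t = relAoI T S (c + t) := by
  obtain ⟨N, M, hs⟩ := h.exists_isStateAt (c + t)
  have hsucc (n : ℤ) : Succeeds (fun n => T n - c) S n ↔ Succeeds T S n := by
    simp only [Succeeds, sub_sub_sub_cancel_right]
  have hs' : IsStateAt (fun n => T n - c) S t N M :=
    ⟨by linarith [hs.arrival_le], by linarith [hs.lt_arrival], (hsucc M).2 hs.succeeds,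
      by linarith [hs.departure_le],
      fun m hm hms => by linarith [hs.lt_departure m hm ((hsucc m).1 hms)]⟩
  rw [hs.relAoI_eq h.strictMono.monotone h.service_nonneg,
    hs'.relAoI_eq (fun a b hab => sub_le_sub_right (h.strictMono.monotone hab) c)
      h.service_nonneg]
  ring

lemma IsRegularPath.relAoI_nonneg (h : IsRegularPath T S) (t : ℝ) : 0 ≤ relAoI T S t := by
  obtain ⟨N, M, hs⟩ := h.exists_isStateAt t
  rw [hs.relAoI_eq h.strictMono.monotone h.service_nonneg, sub_nonneg]
  refine h.strictMono.monotone ?_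
  have : T M < T (N + 1) := by linarith [hs.departure_le, hs.lt_arrival, h.service_nonneg M]
  have := h.strictMono.lt_iff_lt.1 this
  omega

/-- The relative age at time `0` as the sum of the past interarrival intervals that are longer ago
than the arrival of every message that has departed. -/
lemma IsRegularPath.ofReal_relAoI_zero (h : IsRegularPath T S) (h0 : T 0 ≤ 0) (h1 : 0 < T 1) :
    ENNReal.ofReal (relAoI T S 0) = ∑' k : ℕ,
      {S' : ℤ → ℝ | -T 0 < S' 0 ∧ ∀ i ∈ Finset.range k,
        T (-(i : ℤ)) - T (-(i + 1 : ℕ)) ≤ S' (-(i + 1 : ℕ))}.indicator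
        (fun _ => ENNReal.ofReal (T (-(k : ℤ)) - T (-(k + 1 : ℕ)))) S := by
  have hmono := h.strictMono.monotone
  obtain ⟨N, M, hs⟩ := h.exists_isStateAt 0
  have hN : N = 0 := by
    have h2 := h.strictMono.lt_iff_lt.1 (hs.arrival_le.trans_lt h1)
    have h3 := h.strictMono.lt_iff_lt.1 (h0.trans_lt hs.lt_arrival)
    omega
  subst hN
  have hM : M ≤ 0 := by
    have := h.strictMono.lt_iff_lt.1 ((le_add_of_nonneg_right (h.service_nonneg M)).trans_lt
      (hs.departure_le.trans_lt h1))
    omega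
  obtain ⟨m, rfl⟩ : ∃ m : ℕ, M = -(m : ℤ) := ⟨M.natAbs, by omega⟩
  have hcond (k : ℕ) : S ∈ {S' : ℤ → ℝ | -T 0 < S' 0 ∧ ∀ i ∈ Finset.range k,
      T (-(i : ℤ)) - T (-(i + 1 : ℕ)) ≤ S' (-(i + 1 : ℕ))} ↔ k < m := by
    have hfail (i : ℕ) : T (-(i : ℤ)) - T (-(i + 1 : ℕ)) ≤ S (-(i + 1 : ℕ)) ↔
        ¬ Succeeds T S (-(i + 1 : ℕ)) := by
      rw [Succeeds, not_lt, show -((i + 1 : ℕ) : ℤ) + 1 = -(i : ℤ) by push_cast; ring]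
    constructor
    · rintro ⟨hS0, hS⟩
      by_contra! hle
      rcases Nat.eq_zero_or_pos m with rfl | hm
      · have := hs.departure_le
        simp only [Nat.cast_zero, neg_zero] at this
        linarith
      · have := (hfail (m - 1)).1 (hS (m - 1) (by simp; omega))
        rw [Nat.sub_add_cancel hm] at this
        exact this hs.succeeds
    · intro hk
      refine ⟨?_, fun i hi => ?_⟩
      -- If `S 0` is at most the age `-T 0`, then message `0` succeeds, since `T 1 > 0`, and has
      -- departed by time `0`.
      · by_contra! hle
        refine (hs.lt_departure 0 (by omega) ?_).not_ge (by linarith)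
        simp only [Succeeds, zero_add]
        linarith
      · rw [hfail]
        intro hsucc
        rw [Finset.mem_range] at hi
        refine (hs.lt_departure _ (by omega) hsucc).not_ge ?_
        exact ((hsucc.departure_lt_arrival hmono (by omega : _ < (0 : ℤ))).le).trans h0
  -- The terms with `k < m` survive, and they telescope to `T 0 - T (-m)`.
  rw [hs.relAoI_eq hmono h.service_nonneg, tsum_eq_sum (s := Finset.range m)
    fun k hk => Set.indicator_of_notMem (by rw [hcond]; simpa using hk) _,
    Finset.sum_congr rfl fun k hk => Set.indicator_of_mem ((hcond k).2 (by simpa using hk)) _,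
    ← ENNReal.ofReal_sum_of_nonneg fun k _ => sub_nonneg.2 (hmono (by omega)),
    Finset.sum_range_sub' (fun k : ℕ => T (-(k : ℤ)))]
  simp

/-! ### I.i.d. families -/

section IID

variable {ι E : Type*} [MeasurableSpace E] {P : Measure E} [IsProbabilityMeasure P]

/-- Along infinitely many indices, an i.i.d. family almost surely enters every set of positive
probability. -/
lemma ae_infinitePi_exists_mem {J : Set ι} (hJ : J.Infinite) {A : Set E} (hA : MeasurableSet A)
    (hPA : P A ≠ 0) : ∀ᵐ x ∂Measure.infinitePi fun _ : ι => P, ∃ j ∈ J, x j ∈ A := by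
  have hlt : P Aᶜ < 1 := by
    rw [prob_compl_eq_one_sub hA]
    exact ENNReal.sub_lt_self ENNReal.one_ne_top one_ne_zero hPA
  have hle (k : ℕ) : Measure.infinitePi (fun _ : ι => P) {x | ¬ ∃ j ∈ J, x j ∈ A} ≤ P Aᶜ ^ k := by
    obtain ⟨K, hKJ, rfl⟩ := hJ.exists_subset_card_eq k
    calc _ ≤ Measure.infinitePi (fun _ : ι => P) (Set.pi K fun _ => Aᶜ) := by
          refine measure_mono fun x hx j hj => ?_
          simp only [Set.mem_ofPred_eq, not_exists, not_and] at hx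
          exact hx j (hKJ hj)
      _ = P Aᶜ ^ K.card := by
          rw [Measure.infinitePi_pi _ fun _ _ => hA.compl, Finset.prod_const]
  rw [ae_iff]
  exact le_antisymm (ge_of_tendsto' (ENNReal.tendsto_pow_atTop_nhds_zero_of_lt_one hlt) hle)
    zero_le

lemma ae_infinitePi_forall [Countable ι] {p : E → Prop} (hp : ∀ᵐ x ∂P, p x) :
    ∀ᵐ x ∂Measure.infinitePi fun _ : ι => P, ∀ i, p (x i) :=
  ae_all_iff.2 fun i => (measurePreserving_eval_infinitePi _ i).quasiMeasurePreserving.ae hp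

lemma lintegral_infinitePi_prod (s : Finset ι) {f : ι → E → ENNReal} (hf : ∀ i, Measurable (f i)) :
    ∫⁻ x, ∏ i ∈ s, f i (x i) ∂(Measure.infinitePi fun _ : ι => P) =
      ∏ i ∈ s, ∫⁻ x, f i x ∂P := by
  rw [lintegral_prod_eq_prod_lintegral_of_indepFun s _ (iIndepFun_infinitePi hf) fun i => by
    have := hf i; fun_prop]
  exact Finset.prod_congr rfl fun i _ =>
    (measurePreserving_eval_infinitePi (fun _ : ι => P) i).lintegral_comp (hf i)

lemma measurePreserving_infinitePi_shift (k : ℤ) :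
    MeasurePreserving (fun (x : ℤ → E) n => x (n + k)) (Measure.infinitePi fun _ => P)
      (Measure.infinitePi fun _ => P) :=
  ⟨by fun_prop, Measure.map_infinitePi_infinitePi_of_inj (add_left_injective k)⟩

/-- Insertion of a value at one index. -/
lemma measurePreserving_infinitePi_insert [DecidableEq ι] (i : ι) :
    MeasurePreserving (fun (p : E × ({j : ι // j ≠ i} → E)) j =>
      if h : j = i then p.1 else p.2 ⟨j, h⟩)
      (P.prod (Measure.infinitePi fun _ => P)) (Measure.infinitePi fun _ => P) := by
  have hm : Measurable (fun (p : E × ({j : ι // j ≠ i} → E)) j =>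
      if h : j = i then p.1 else p.2 ⟨j, h⟩) := by
    refine measurable_pi_lambda _ fun j => ?_
    split_ifs <;> fun_prop
  refine ⟨hm, Measure.eq_infinitePi _ fun s t ht => ?_⟩
  rw [Measure.map_apply hm (.pi s.countable_toSet fun j _ => ht j)]
  have hpre : (fun (p : E × ({j : ι // j ≠ i} → E)) j => if h : j = i then p.1 else p.2 ⟨j, h⟩) ⁻¹'
      Set.pi s t = (if i ∈ s then t i else Set.univ) ×ˢ
        (SetLike.coe (s.subtype (· ≠ i)) : Set {j : ι // j ≠ i}).pi fun j => t j := by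
    ext ⟨x, y⟩
    simp only [Set.mem_preimage, Set.mem_pi, Set.mem_prod, SetLike.mem_coe, Finset.mem_subtype]
    constructor
    · intro h
      refine ⟨?_, fun j hj => by simpa [j.2] using h j hj⟩
      split_ifs with hi
      · simpa using h i hi
      · trivial
    · rintro ⟨h1, h2⟩ j hj
      split_ifs with h
      · subst h; simpa [hj] using h1
      · exact h2 ⟨j, h⟩ hj
  rw [hpre, Measure.prod_prod,
    Measure.infinitePi_pi (t := fun j : {j : ι // j ≠ i} => t j) _ fun j _ => ht j,
    Finset.prod_subtype_eq_prod_filter (f := fun j => P (t j)), Finset.filter_ne']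
  split_ifs with hi
  · exact Finset.mul_prod_erase s (fun j => P (t j)) hi
  · rw [measure_univ, one_mul, Finset.erase_eq_of_notMem hi]

end IID

/-! ### Arrival times as partial sums -/

/-- The arrival times with interarrival times `X`, when message `0` arrives at time `0`. -/
noncomputable def epoch (X : ℤ → ℝ) (n : ℤ) : ℝ :=
  ∑ k ∈ Finset.Ico 0 n, X k - ∑ k ∈ Finset.Ico n 0, X k

@[simp]
lemma epoch_zero (X : ℤ → ℝ) : epoch X 0 = 0 := by simp [epoch]

lemma epoch_add_one (X : ℤ → ℝ) (n : ℤ) : epoch X (n + 1) = epoch X n + X n := by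
  unfold epoch
  rcases le_or_gt 0 n with h | h
  · rw [← Finset.insert_Ico_right_eq_Ico_add_one h, Finset.sum_insert (by simp),
      Finset.Ico_eq_empty (a := n) (by omega), Finset.Ico_eq_empty (a := n + 1) (by omega)]
    ring
  · rw [← Finset.insert_Ico_add_one_left_eq_Ico h, Finset.sum_insert (by simp),
      Finset.Ico_eq_empty (b := n) (by omega), Finset.Ico_eq_empty (b := n + 1) (by omega)]
    ring

/-- The cocycle identity that makes renumbering an action on the suspension. -/
lemma epoch_shift (X : ℤ → ℝ) (k n : ℤ) :
    epoch (fun j => X (j + k)) n = epoch X (n + k) - epoch X k := by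
  induction n using Int.induction_on with
  | zero => simp
  | succ n ih => rw [epoch_add_one, ih, add_right_comm, epoch_add_one]; ring
  | pred n ih =>
    have h1 := epoch_add_one (fun j => X (j + k)) (-n - 1)
    have h2 := epoch_add_one X (-n - 1 + k)
    rw [show -(n : ℤ) - 1 + k + 1 = -n + k by ring] at h2
    rw [sub_add_cancel] at h1
    linarith

@[fun_prop]
lemma measurable_epoch (n : ℤ) : Measurable fun X : ℤ → ℝ => epoch X n := by
  unfold epoch
  fun_prop

lemma strictMono_epoch {X : ℤ → ℝ} (hX : ∀ n, 0 < X n) : StrictMono (epoch X) :=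
  strictMono_int_of_lt_succ fun n => by rw [epoch_add_one]; linarith [hX n]

/-- Every gap longer than `c` moves the partial sums by more than `c`, and infinitely many of them
on each side make the arrival times unbounded. A service shorter than `c` in such a gap is a
success. -/
lemma isRegularPath_epoch {X S : ℤ → ℝ} {c : ℝ} (hc : 0 < c) (hX : ∀ n, 0 < X n)
    (hS : ∀ n, 0 ≤ S n) (hfuture : ∀ m, ∃ n ≥ m, c < X n)
    (hpast : ∀ m, ∃ n ≤ m, c < X n ∧ S n < c) : IsRegularPath (epoch X) S where
  strictMono := strictMono_epoch hX
  service_nonneg := hS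
  exists_arrival_le t := by
    have key (j : ℕ) : ∃ n, epoch X n ≤ -(j * c) := by
      induction j with
      | zero => exact ⟨0, by simp⟩
      | succ j ih =>
        obtain ⟨n, hn⟩ := ih
        obtain ⟨m, hm, hXm, -⟩ := hpast (n - 1)
        refine ⟨m, ?_⟩
        have h1 : epoch X (m + 1) ≤ epoch X n := (strictMono_epoch hX).monotone (by omega)
        rw [epoch_add_one] at h1
        push_cast
        linarith
    obtain ⟨j, hj⟩ := exists_nat_ge (-t / c)
    obtain ⟨n, hn⟩ := key j
    rw [div_le_iff₀ hc] at hj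
    exact ⟨n, by linarith⟩
  exists_lt_arrival t := by
    have key (j : ℕ) : ∃ n, j * c ≤ epoch X n := by
      induction j with
      | zero => exact ⟨0, by simp⟩
      | succ j ih =>
        obtain ⟨n, hn⟩ := ih
        obtain ⟨m, hm, hXm⟩ := hfuture n
        refine ⟨m + 1, ?_⟩
        have h1 : epoch X n ≤ epoch X m := (strictMono_epoch hX).monotone hm
        rw [epoch_add_one]
        push_cast
        linarith
    obtain ⟨j, hj⟩ := exists_nat_gt (t / c)
    obtain ⟨n, hn⟩ := key j
    rw [div_lt_iff₀ hc] at hj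
    exact ⟨n, by linarith⟩
  exists_succeeds_le m := by
    obtain ⟨n, hn, hXn, hSn⟩ := hpast m
    refine ⟨n, hn, ?_⟩
    rw [Succeeds, epoch_add_one]
    linarith

/-- Conditions on the interarrival law `F` and the service law `G` under which almost every path is
regular: some `c > 0` lies below an interarrival time and above a service time with positive
probability. -/
structure IsNondegenerate (F G : Measure ℝ) : Prop where
  gap_pos : ∀ᵐ x ∂F, 0 < x
  service_nonneg : ∀ᵐ s ∂G, 0 ≤ s
  exists_between : ∃ c > 0, F (Set.Ioi c) ≠ 0 ∧ G (Set.Iio c) ≠ 0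

variable {F G : Measure ℝ} [IsProbabilityMeasure F] [IsProbabilityMeasure G]

lemma IsNondegenerate.ae_isRegularPath (h : IsNondegenerate F G) :
    ∀ᵐ ξ ∂(Measure.infinitePi fun _ : ℤ => F).prod (Measure.infinitePi fun _ : ℤ => G),
      IsRegularPath (epoch ξ.1) ξ.2 := by
  obtain ⟨c, hc, hFc, hGc⟩ := h.exists_between
  have hX : ∀ᵐ X ∂Measure.infinitePi fun _ : ℤ => F,
      (∀ n, 0 < X n) ∧ (∀ m, ∃ n ≥ m, c < X n) ∧ ∀ m, ∃ n ≤ m, c < X n := by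
    refine (ae_infinitePi_forall h.gap_pos).and (Filter.Eventually.and ?_ ?_)
    · exact ae_all_iff.2 fun m =>
        ae_infinitePi_exists_mem (Set.Ici_infinite m) measurableSet_Ioi hFc
    · exact ae_all_iff.2 fun m =>
        ae_infinitePi_exists_mem (Set.Iic_infinite m) measurableSet_Ioi hFc
  have hmeas : MeasurableSet {ξ : (ℤ → ℝ) × (ℤ → ℝ) | ∀ m, ∃ n ≤ m, c < ξ.1 n ∧ ξ.2 n < c} := by
    simp only [Set.ofPred_forall, Set.ofPred_exists, Set.ofPred_and]
    refine .iInter fun m => .iUnion fun n => .inter (.const _) (.inter ?_ ?_)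
    · exact measurableSet_lt (by fun_prop) (by fun_prop)
    · exact measurableSet_lt (by fun_prop) (by fun_prop)
  have hpast : ∀ᵐ ξ ∂(Measure.infinitePi fun _ : ℤ => F).prod (Measure.infinitePi fun _ : ℤ => G),
      ξ ∈ {ξ : (ℤ → ℝ) × (ℤ → ℝ) | ∀ m, ∃ n ≤ m, c < ξ.1 n ∧ ξ.2 n < c} := by
    -- With the gaps fixed, the service times are i.i.d. along the infinite set of past indices
    -- whose gap exceeds `c`.
    rw [Measure.ae_prod_mem_iff_ae_ae_mem hmeas]
    filter_upwards [hX] with X hX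
    refine ae_all_iff.2 fun m => ?_
    have hinf : {n | n ≤ m ∧ c < X n}.Infinite := by
      intro hfin
      obtain ⟨b, hb⟩ := hfin.bddBelow
      obtain ⟨n, hn, hXn⟩ := hX.2.2 (min m (b - 1))
      have := hb ⟨(le_min_iff.1 hn).1, hXn⟩
      omega
    filter_upwards [ae_infinitePi_exists_mem hinf measurableSet_Iio hGc] with S hS
    obtain ⟨n, ⟨hn, hXn⟩, hSn⟩ := hS
    exact ⟨n, hn, hXn, hSn⟩
  filter_upwards [hpast, Measure.quasiMeasurePreserving_fst.ae hX,
    Measure.quasiMeasurePreserving_snd.ae (ae_infinitePi_forall h.service_nonneg)] with ξ h1 h2 h3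
  exact isRegularPath_epoch hc h2.1 h3 h2.2.1 h1

/-! ### Measurability of the relative age -/

/-- The suprema are not visibly measurable, but the countably many events `IsStateAt` cover `R`, and
on each of them the relative age is a difference of two arrival times. -/
lemma measurable_indicator_relAoI {Ω : Type*} [MeasurableSpace Ω] {T S : Ω → ℤ → ℝ}
    (hT : Measurable T) (hS : Measurable S) {R : Set Ω} (hR : MeasurableSet R)
    (h : ∀ ω ∈ R, IsRegularPath (T ω) (S ω)) :
    Measurable (R.indicator fun ω => relAoI (T ω) (S ω)) := by
  refine measurable_pi_lambda _ fun t => ?_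
  have hT' (n : ℤ) : Measurable fun ω => T ω n := (measurable_pi_apply n).comp hT
  have hS' (n : ℤ) : Measurable fun ω => S ω n := (measurable_pi_apply n).comp hS
  have hsucc (n : ℤ) : MeasurableSet {ω | Succeeds (T ω) (S ω) n} :=
    measurableSet_lt (hS' n) ((hT' (n + 1)).sub (hT' n))
  have hE (p : ℤ × ℤ) : MeasurableSet {ω | IsStateAt (T ω) (S ω) t p.1 p.2} := by
    have : {ω | IsStateAt (T ω) (S ω) t p.1 p.2} =
        {ω | T ω p.1 ≤ t} ∩ {ω | t < T ω (p.1 + 1)} ∩ {ω | Succeeds (T ω) (S ω) p.2} ∩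
        {ω | T ω p.2 + S ω p.2 ≤ t} ∩
        ⋂ (m : ℤ) (_ : p.2 < m), {ω | Succeeds (T ω) (S ω) m}ᶜ ∪ {ω | t < T ω m + S ω m} := by
      ext ω
      simp only [Set.mem_ofPred_eq, Set.mem_inter_iff, Set.mem_iInter, Set.mem_union,
        Set.mem_compl_iff]
      constructor
      · intro h
        exact ⟨⟨⟨⟨h.1, h.2⟩, h.3⟩, h.4⟩, fun m hm => not_or_of_imp (h.5 m hm)⟩
      · rintro ⟨⟨⟨⟨h1, h2⟩, h3⟩, h4⟩, h5⟩
        exact ⟨h1, h2, h3, h4, fun m hm hs => (h5 m hm).resolve_left (not_not.2 hs)⟩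
    rw [this]
    refine ((((measurableSet_le (hT' _) measurable_const).inter
      (measurableSet_lt measurable_const (hT' _))).inter (hsucc _)).inter
      (measurableSet_le ((hT' _).add (hS' _)) measurable_const)).inter
      (.iInter fun m => .iInter fun _ => (hsucc m).compl.union
        (measurableSet_lt measurable_const ((hT' _).add (hS' _))))
  have heq : (fun ω => R.indicator (fun ω => relAoI (T ω) (S ω)) ω t) =
      R.indicator fun ω => relAoI (T ω) (S ω) t := by
    funext ω
    by_cases hω : ω ∈ R <;> simp [hω]
  rw [heq]
  intro B hB
  have hpre : (fun ω => relAoI (T ω) (S ω) t) ⁻¹' B ∩ R = ⋃ p : ℤ × ℤ,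
      (fun ω => T ω p.1 - T ω p.2) ⁻¹' B ∩ {ω | IsStateAt (T ω) (S ω) t p.1 p.2} ∩ R := by
    ext ω
    simp only [Set.mem_inter_iff, Set.mem_preimage, Set.mem_iUnion, Set.mem_ofPred_eq]
    constructor
    · rintro ⟨hB, hω⟩
      obtain ⟨N, M, hs⟩ := (h ω hω).exists_isStateAt t
      rw [hs.relAoI_eq (h ω hω).strictMono.monotone (h ω hω).service_nonneg] at hB
      exact ⟨(N, M), ⟨hB, hs⟩, hω⟩
    · rintro ⟨p, ⟨hB, hs⟩, hω⟩
      rw [hs.relAoI_eq (h ω hω).strictMono.monotone (h ω hω).service_nonneg]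
      exact ⟨hB, hω⟩
  rw [Set.indicator_preimage, Set.ite, hpre]
  exact (MeasurableSet.iUnion fun p => ((((hT' _).sub (hT' _)) hB).inter (hE p)).inter hR).union
    ((measurable_const hB).diff hR)

lemma aemeasurable_relAoI {Ω : Type*} [MeasurableSpace Ω] {μ : Measure Ω} {T S : Ω → ℤ → ℝ}
    (hT : Measurable T) (hS : Measurable S) (h : ∀ᵐ ω ∂μ, IsRegularPath (T ω) (S ω)) :
    AEMeasurable (fun ω => relAoI (T ω) (S ω)) μ := by
  obtain ⟨R, hsub, hR, hRμ⟩ :=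
    exists_measurable_superset_of_null (ae_iff.1 h)
  refine ⟨_, measurable_indicator_relAoI hT hS hR.compl fun ω hω => ?_, ?_⟩
  · by_contra hn
    exact hω (hsub hn)
  · filter_upwards [compl_mem_ae_iff.2 hRμ] with ω hω
    rw [Set.indicator_of_mem hω]

/-! ### The suspension flow -/

/-- Points `((X, S), a)`: interarrival times, service times, and the age at time `0` of message `0`,
with no constraint on `a`. Points that differ by a renumbering of the messages describe the same
path. -/
def Suspension : Type := ((ℤ → ℝ) × (ℤ → ℝ)) × ℝ

namespace Suspension

instance : MeasurableSpace Suspension :=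
  inferInstanceAs (MeasurableSpace (((ℤ → ℝ) × (ℤ → ℝ)) × ℝ))

/-- Renumbering of the messages. -/
noncomputable instance : AddAction ℤ Suspension where
  vadd k y := ((fun n => y.1.1 (n + k), fun n => y.1.2 (n + k)), y.2 - epoch y.1.1 k)
  zero_vadd y := by
    change (((fun n => y.1.1 (n + 0), fun n => y.1.2 (n + 0)), y.2 - epoch y.1.1 0) :
      ((ℤ → ℝ) × (ℤ → ℝ)) × ℝ) = y
    simp only [add_zero, epoch_zero, sub_zero]
    rfl
  add_vadd j k y := by
    change (((fun n => y.1.1 (n + (j + k)), fun n => y.1.2 (n + (j + k))),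
      y.2 - epoch y.1.1 (j + k)) : ((ℤ → ℝ) × (ℤ → ℝ)) × ℝ) =
      ((fun n => y.1.1 (n + j + k), fun n => y.1.2 (n + j + k)),
        y.2 - epoch y.1.1 k - epoch (fun n => y.1.1 (n + k)) j)
    simp only [epoch_shift, add_assoc, Prod.mk.injEq, true_and]
    ring

/-- The arrival times. -/
noncomputable def arrival (y : Suspension) (n : ℤ) : ℝ := epoch y.1.1 n - y.2

/-- The relative age process. -/
noncomputable def age (y : Suspension) : ℝ → ℝ := relAoI y.arrival y.1.2

lemma arrival_vadd (k : ℤ) (y : Suspension) : (k +ᵥ y).arrival = fun n => y.arrival (n + k) := by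
  funext n
  change epoch (fun n => y.1.1 (n + k)) n - (y.2 - epoch y.1.1 k) = epoch y.1.1 (n + k) - y.2
  rw [epoch_shift]
  ring

lemma age_vadd (k : ℤ) (y : Suspension) : (k +ᵥ y).age = y.age := by
  rw [age, arrival_vadd]
  exact relAoI_comp_add_right y.arrival y.1.2 k

/-- The points for which message `0` is the last one that has arrived by time `-c`. -/
def domain (c : ℝ) : Set Suspension := {y | c ≤ y.2 ∧ y.2 < c + y.1.1 0}

lemma vadd_mem_domain {c : ℝ} {k : ℤ} {y : Suspension} :
    k +ᵥ y ∈ domain c ↔ y.arrival k ≤ -c ∧ -c < y.arrival (k + 1) := by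
  change c ≤ y.2 - epoch y.1.1 k ∧ y.2 - epoch y.1.1 k < c + y.1.1 (0 + k) ↔
    epoch y.1.1 k - y.2 ≤ -c ∧ -c < epoch y.1.1 (k + 1) - y.2
  rw [epoch_add_one, zero_add]
  constructor <;> rintro ⟨h1, h2⟩ <;> constructor <;> linarith

lemma measurable_fst_fst : Measurable fun y : Suspension => y.1.1 :=
  measurable_fst.comp (measurable_fst (α := (ℤ → ℝ) × (ℤ → ℝ)) (β := ℝ))

lemma measurable_fst_snd : Measurable fun y : Suspension => y.1.2 :=
  measurable_snd.comp (measurable_fst (α := (ℤ → ℝ) × (ℤ → ℝ)) (β := ℝ))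

lemma measurable_snd : Measurable fun y : Suspension => y.2 :=
  _root_.measurable_snd (α := (ℤ → ℝ) × (ℤ → ℝ)) (β := ℝ)

lemma measurable_arrival : Measurable arrival :=
  measurable_pi_lambda _ fun n => ((measurable_epoch n).comp measurable_fst_fst).sub measurable_snd

lemma measurableSet_domain (c : ℝ) : MeasurableSet (domain c) :=
  (measurableSet_le measurable_const measurable_snd).inter
    (measurableSet_lt measurable_snd
      (measurable_const.add ((measurable_pi_apply 0).comp measurable_fst_fst)))

/-- I.i.d. interarrival times, i.i.d. service times, and Lebesgue measure. -/
noncomputable def law (F G : Measure ℝ) : Measure Suspension :=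
  ((Measure.infinitePi fun _ : ℤ => F).prod (Measure.infinitePi fun _ : ℤ => G)).prod volume

/-- A skew product: an index shift of i.i.d. sequences in the base, and in each fibre a translation
of Lebesgue measure by an amount that depends on the base point. -/
lemma measurePreserving_vadd (k : ℤ) :
    MeasurePreserving (fun y : Suspension => k +ᵥ y) (law F G) (law F G) := by
  refine MeasurePreserving.skew_product
    (f := fun ξ : (ℤ → ℝ) × (ℤ → ℝ) => (fun n => ξ.1 (n + k), fun n => ξ.2 (n + k)))
    (g := fun ξ a => a - epoch ξ.1 k)
    ((measurePreserving_infinitePi_shift k).prod (measurePreserving_infinitePi_shift k)) ?_ ?_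
  · exact _root_.measurable_snd.sub
      ((measurable_epoch k).comp (measurable_fst.comp measurable_fst))
  · exact ae_of_all _ fun ξ => (measurePreserving_sub_right volume _).map_eq

instance : MeasurableConstVAdd ℤ Suspension where
  -- Measurability does not involve the laws, so any probability measures serve here.
  measurable_const_vadd k := (measurePreserving_vadd (F := .dirac 0) (G := .dirac 0) k).measurable

instance : VAddInvariantMeasure ℤ Suspension (law F G) where
  measure_preimage_vadd k _ hs :=
    (measurePreserving_vadd k).measure_preimage hs.nullMeasurableSet

lemma measurePreserving_translate (s : ℝ) :
    MeasurePreserving (fun y : Suspension => ((y.1, y.2 + s) : Suspension)) (law F G) (law F G) :=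
  (MeasurePreserving.id _).prod (measurePreserving_add_right volume s)

lemma ae_isRegularPath (h : IsNondegenerate F G) :
    ∀ᵐ y ∂law F G, IsRegularPath y.arrival y.1.2 := by
  filter_upwards [Measure.quasiMeasurePreserving_fst.ae h.ae_isRegularPath]
    with (y : Suspension) (hy : IsRegularPath (epoch y.1.1) y.1.2)
  refine ⟨fun a b hab => sub_lt_sub_right (hy.strictMono hab) _, hy.service_nonneg,
    fun t => ?_, fun t => ?_, fun m => ?_⟩
  · obtain ⟨n, hn⟩ := hy.exists_arrival_le (t + y.2)
    exact ⟨n, sub_le_iff_le_add.2 hn⟩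
  · obtain ⟨n, hn⟩ := hy.exists_lt_arrival (t + y.2)
    exact ⟨n, lt_sub_iff_add_lt.2 hn⟩
  · obtain ⟨n, hn, hs⟩ := hy.exists_succeeds_le m
    refine ⟨n, hn, ?_⟩
    simpa only [Succeeds, arrival, sub_sub_sub_cancel_right] using hs

/-- On a regular path exactly one message is the last to have arrived by time `-c`, so exactly one
renumbering gives it index `0`. -/
lemma isAddFundamentalDomain_domain (h : IsNondegenerate F G) (c : ℝ) :
    IsAddFundamentalDomain ℤ (domain c) (law F G) := by
  refine .mk'' (measurableSet_domain c).nullMeasurableSet ?_ (fun k hk => ?_)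
    fun k => (measurePreserving_vadd k).quasiMeasurePreserving
  · filter_upwards [ae_isRegularPath h] with y hy
    obtain ⟨N, M, hs⟩ := hy.exists_isStateAt (-c)
    exact ⟨N, vadd_mem_domain.2 ⟨hs.arrival_le, hs.lt_arrival⟩⟩
  · refine measure_mono_null ?_ (ae_iff.1 (ae_isRegularPath h))
    rintro y ⟨hy1, hy2⟩ hy
    rw [Set.mem_vadd_set_iff_neg_vadd_mem, vadd_mem_domain] at hy1
    rw [← zero_vadd ℤ y, vadd_mem_domain] at hy2
    have h1 := hy.strictMono.lt_iff_lt.1 (hy1.1.trans_lt hy2.2)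
    have h2 := hy.strictMono.lt_iff_lt.1 (hy2.1.trans_lt hy1.2)
    omega

lemma aemeasurable_age (h : IsNondegenerate F G) : AEMeasurable age (law F G) :=
  aemeasurable_relAoI measurable_arrival measurable_fst_snd (ae_isRegularPath h)

lemma age_translate {y : Suspension} (hy : IsRegularPath y.arrival y.1.2) (s : ℝ) :
    age ((y.1, y.2 + s) : Suspension) = fun t => age y (s + t) := by
  funext t
  have harr : arrival ((y.1, y.2 + s) : Suspension) = fun n => y.arrival n - s := by
    funext n
    change epoch y.1.1 n - (y.2 + s) = epoch y.1.1 n - y.2 - s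
    ring
  change relAoI (arrival ((y.1, y.2 + s) : Suspension)) y.1.2 t = relAoI y.arrival y.1.2 (s + t)
  rw [harr]
  exact hy.relAoI_sub s t

/-- The relative age process is stationary. -/
lemma identDistrib_age (h : IsNondegenerate F G) (s : ℝ) :
    IdentDistrib (fun y t => age y (s + t)) age ((law F G).restrict (domain 0))
      ((law F G).restrict (domain 0)) := by
  have hage := aemeasurable_age h
  have htr := measurePreserving_translate (F := F) (G := G) s
  have hshift : AEMeasurable (fun y t => age y (s + t)) (law F G) :=
    (measurable_pi_lambda (fun (f : ℝ → ℝ) t => f (s + t))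
      fun t => measurable_pi_apply (s + t)).comp_aemeasurable hage
  refine ⟨hshift.restrict, hage.restrict, Measure.ext fun B hB => ?_⟩
  rw [Measure.map_apply_of_aemeasurable hshift.restrict hB,
    Measure.map_apply_of_aemeasurable hage.restrict hB,
    Measure.restrict_apply' (measurableSet_domain 0),
    Measure.restrict_apply' (measurableSet_domain 0)]
  have hnull (c : ℝ) : NullMeasurableSet (age ⁻¹' B ∩ domain c) (law F G) :=
    (hage.nullMeasurableSet_preimage hB).inter (measurableSet_domain c).nullMeasurableSet
  calc law F G ((fun y t => age y (s + t)) ⁻¹' B ∩ domain 0)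
      = law F G ((fun y : Suspension => ((y.1, y.2 + s) : Suspension)) ⁻¹'
          (age ⁻¹' B ∩ domain s)) := by
        refine measure_congr ?_
        filter_upwards [ae_isRegularPath h] with y hy
        refine propext (and_congr ?_ ?_)
        · change (fun t => age y (s + t)) ∈ B ↔ age ((y.1, y.2 + s) : Suspension) ∈ B
          rw [age_translate hy]
        · change 0 ≤ y.2 ∧ y.2 < 0 + y.1.1 0 ↔ s ≤ y.2 + s ∧ y.2 + s < s + y.1.1 0
          constructor <;> rintro ⟨h1, h2⟩ <;> constructor <;> linarith
    _ = law F G (age ⁻¹' B ∩ domain s) := htr.measure_preimage (hnull s)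
    _ = law F G (age ⁻¹' B ∩ domain 0) := by
        -- The indicator of `age ⁻¹' B` is invariant under renumbering, so its integrals over two
        -- fundamental domains agree.
        have := (isAddFundamentalDomain_domain h s).setLIntegral_eq
          (isAddFundamentalDomain_domain h 0) ((age ⁻¹' B).indicator 1) fun k y => by
            have hiff : k +ᵥ y ∈ age ⁻¹' B ↔ y ∈ age ⁻¹' B := by
              rw [Set.mem_preimage, Set.mem_preimage, age_vadd]
            by_cases hy : y ∈ age ⁻¹' B
            · exact (Set.indicator_of_mem (hiff.2 hy) 1).trans (Set.indicator_of_mem hy 1).symm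
            · exact (Set.indicator_of_notMem (mt hiff.1 hy) 1).trans
                (Set.indicator_of_notMem hy 1).symm
        rwa [lintegral_indicator_one₀ (hage.restrict.nullMeasurableSet_preimage hB),
          lintegral_indicator_one₀ (hage.restrict.nullMeasurableSet_preimage hB),
          Measure.restrict_apply' (measurableSet_domain _),
          Measure.restrict_apply' (measurableSet_domain _)] at this

end Suspension

/-! ### The stationary law -/

lemma lintegral_inspectionLaw {F : Measure ℝ} {f : ℝ → ENNReal} (hf : Measurable f) :
    ∫⁻ p, f p.2 ∂inspectionLaw F =
      (∫⁻ x, ENNReal.ofReal x ∂F)⁻¹ * ∫⁻ x, (∫⁻ a in Set.Ico 0 x, f a) ∂F := by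
  have hA : MeasurableSet {p : ℝ × ℝ | 0 ≤ p.2 ∧ p.2 < p.1} :=
    (measurableSet_le measurable_const measurable_snd).inter
      (measurableSet_lt measurable_snd measurable_fst)
  rw [inspectionLaw, lintegral_smul_measure, smul_eq_mul, ← lintegral_indicator hA,
    lintegral_prod _ ((by fun_prop : Measurable fun p : ℝ × ℝ => f p.2).indicator hA).aemeasurable]
  congr 1
  refine lintegral_congr fun x => ?_
  rw [← lintegral_indicator measurableSet_Ico]
  rfl

lemma isProbabilityMeasure_inspectionLaw {F : Measure ℝ} (h0 : ∫⁻ x, ENNReal.ofReal x ∂F ≠ 0)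
    (htop : ∫⁻ x, ENNReal.ofReal x ∂F ≠ ⊤) : IsProbabilityMeasure (inspectionLaw F) := by
  refine ⟨?_⟩
  have h := lintegral_inspectionLaw (F := F) (f := fun _ => 1) measurable_const
  simp only [lintegral_const, one_mul, Measure.restrict_apply_univ, Real.volume_Ico, sub_zero] at h
  rw [h, ENNReal.inv_mul_cancel h0 htop]

/-- The point of the suspension given by a sample point. -/
def toSuspension (ω : Sample) : Suspension := ((gap ω, service ω), ω.1.2)

lemma arrival_eq (ω : Sample) : arrival ω = (toSuspension ω).arrival := by
  funext n
  change -ω.1.2 + ∑ k ∈ Finset.Ico 0 n, gap ω k - ∑ k ∈ Finset.Ico n 0, gap ω k =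
    (∑ k ∈ Finset.Ico 0 n, gap ω k - ∑ k ∈ Finset.Ico n 0, gap ω k) - ω.1.2
  ring

lemma Delta_eq (ω : Sample) : Delta ω = (toSuspension ω).age := by
  funext t
  rw [Delta, arrival_eq]
  rfl

lemma measurePreserving_toSuspension_prod :
    MeasurePreserving toSuspension ((F.prod volume).prod
      ((Measure.infinitePi fun _ : {n : ℤ // n ≠ 0} => F).prod (Measure.infinitePi fun _ : ℤ => G)))
      (Suspension.law F G) := by
  have hins := measurePreserving_infinitePi_insert (P := F) (0 : ℤ)
  have e1 := measurePreserving_prodAssoc F (volume : Measure ℝ)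
    ((Measure.infinitePi fun _ : {n : ℤ // n ≠ 0} => F).prod (Measure.infinitePi fun _ : ℤ => G))
  have e2 := (Measure.measurePreserving_swap (μ := (volume : Measure ℝ))
    (ν := (Measure.infinitePi fun _ : {n : ℤ // n ≠ 0} => F).prod
      (Measure.infinitePi fun _ : ℤ => G)))
  have e3 := measurePreserving_prodAssoc (Measure.infinitePi fun _ : {n : ℤ // n ≠ 0} => F)
    (Measure.infinitePi fun _ : ℤ => G) (volume : Measure ℝ)
  have e4 := (measurePreserving_prodAssoc F (Measure.infinitePi fun _ : {n : ℤ // n ≠ 0} => F)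
    ((Measure.infinitePi fun _ : ℤ => G).prod (volume : Measure ℝ))).symm
  have e5 := (measurePreserving_prodAssoc (Measure.infinitePi fun _ : ℤ => F)
    (Measure.infinitePi fun _ : ℤ => G) (volume : Measure ℝ)).symm
  exact e5.comp ((hins.prod (.id _)).comp
    (e4.comp (((MeasurePreserving.id F).prod (e3.comp e2)).comp e1)))

/-- The constraint `0 ≤ a < x` of the inspection law is membership in `domain 0`; size-biasing is
thus nothing but restriction and normalisation. -/
lemma measurePreserving_toSuspension :
    MeasurePreserving toSuspension (stationaryLaw F G)
      ((∫⁻ x, ENNReal.ofReal x ∂F)⁻¹ • (Suspension.law F G).restrict (Suspension.domain 0)) := by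
  have hpre : toSuspension ⁻¹' Suspension.domain 0 =
      {p : ℝ × ℝ | 0 ≤ p.2 ∧ p.2 < p.1} ×ˢ Set.univ := by
    ext ω
    change 0 ≤ ω.1.2 ∧ ω.1.2 < 0 + gap ω 0 ↔ (0 ≤ ω.1.2 ∧ ω.1.2 < ω.1.1) ∧ True
    simp [gap]
  have h := (measurePreserving_toSuspension_prod (F := F) (G := G)).restrict_preimage
    (Suspension.measurableSet_domain 0)
  rw [hpre, ← Measure.prod_restrict, Measure.restrict_univ] at h
  rw [stationaryLaw, inspectionLaw, Measure.prod_smul_left]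
  exact ⟨h.measurable, by rw [Measure.map_smul, h.map_eq]⟩

lemma ae_isRegularPath (h : IsNondegenerate F G) :
    ∀ᵐ ω ∂stationaryLaw F G, IsRegularPath (arrival ω) (service ω) ∧ 0 ≤ ω.1.2 ∧ ω.1.2 < ω.1.1 := by
  have hac : (∫⁻ x, ENNReal.ofReal x ∂F)⁻¹ •
      (Suspension.law F G).restrict (Suspension.domain 0) ≪
      (Suspension.law F G).restrict (Suspension.domain 0) := Measure.smul_absolutelyContinuous
  have hq := measurePreserving_toSuspension (F := F) (G := G).quasiMeasurePreserving
  filter_upwards [hq.ae (hac.ae_le (ae_restrict_of_ae (Suspension.ae_isRegularPath h))),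
    hq.ae (hac.ae_le (ae_restrict_mem (Suspension.measurableSet_domain 0)))] with ω h1 h2
  refine ⟨by rw [arrival_eq]; exact h1, h2.1, ?_⟩
  have h3 : ω.1.2 < 0 + gap ω 0 := h2.2
  simpa [gap] using h3

/-- The relative age process is stationary. -/
lemma identDistrib_Delta (h : IsNondegenerate F G) (s : ℝ) :
    IdentDistrib (fun ω t => Delta ω (s + t)) (fun ω t => Delta ω t)
      (stationaryLaw F G) (stationaryLaw F G) := by
  have hpres := measurePreserving_toSuspension (F := F) (G := G)
  have hid := Suspension.identDistrib_age h s
  have h1 : AEMeasurable (fun (y : Suspension) t => y.age (s + t))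
      ((stationaryLaw F G).map toSuspension) :=
    hpres.map_eq ▸ hid.aemeasurable_fst.smul_measure _
  have h2 : AEMeasurable Suspension.age ((stationaryLaw F G).map toSuspension) :=
    hpres.map_eq ▸ hid.aemeasurable_snd.smul_measure _
  have e1 := AEMeasurable.map_map_of_aemeasurable h1 hpres.aemeasurable
  have e2 := AEMeasurable.map_map_of_aemeasurable h2 hpres.aemeasurable
  rw [hpres.map_eq, Measure.map_smul, hid.map_eq] at e1
  rw [hpres.map_eq, Measure.map_smul] at e2
  simp only [Delta_eq]
  exact ⟨h1.comp_measurable hpres.measurable, h2.comp_measurable hpres.measurable,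
    e1.symm.trans e2⟩

/-! ### The mean relative age -/

/-- The index of the interarrival interval that is `i + 1` intervals in the past. -/
def past (i : ℕ) : {n : ℤ // n ≠ 0} := ⟨-(i + 1 : ℕ), by omega⟩

lemma past_injective : Function.Injective past := by
  intro i j h
  have := congrArg Subtype.val h
  simp only [past] at this
  omega

lemma gap_neg_succ (ω : Sample) (i : ℕ) : gap ω (-(i + 1 : ℕ)) = ω.2.1 (past i) :=
  dif_neg (past i).2

lemma arrival_neg_sub (ω : Sample) (i : ℕ) :
    arrival ω (-(i : ℤ)) - arrival ω (-(i + 1 : ℕ)) = ω.2.1 (past i) := by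
  have h := epoch_add_one (gap ω) (-(i + 1 : ℕ))
  rw [show -((i + 1 : ℕ) : ℤ) + 1 = -(i : ℤ) by push_cast; ring] at h
  rw [arrival_eq, ← gap_neg_succ]
  change (epoch (gap ω) (-(i : ℤ)) - ω.1.2) - (epoch (gap ω) (-(i + 1 : ℕ)) - ω.1.2) = _
  linarith

lemma infinitePi_past_box (A : Set ℝ) (hA : MeasurableSet A) (B : ℕ → Set ℝ)
    (hB : ∀ i, MeasurableSet (B i)) (k : ℕ) :
    Measure.infinitePi (fun _ : ℤ => G)
      {S | S 0 ∈ A ∧ ∀ i ∈ Finset.range k, S (-(i + 1 : ℕ)) ∈ B i} =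
      G A * ∏ i ∈ Finset.range k, G (B i) := by
  have hinj : Function.Injective fun i : ℕ => -(i : ℤ) := fun i j h => by simpa using h
  -- Along `i ↦ -i`, coordinate `0` must lie in `A` and coordinate `-(i + 1)` in `B i`.
  have hmeas (i : ℕ) : MeasurableSet (Nat.casesOn i A B : Set ℝ) := by
    cases i
    · exact hA
    · exact hB _
  have hset : {S : ℤ → ℝ | S 0 ∈ A ∧ ∀ i ∈ Finset.range k, S (-(i + 1 : ℕ)) ∈ B i} =
      (fun (S : ℤ → ℝ) (i : ℕ) => S (-(i : ℤ))) ⁻¹'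
        Set.pi (Finset.range (k + 1)) fun i => (Nat.casesOn i A B : Set ℝ) := by
    ext S
    simp only [Set.mem_ofPred_eq, Set.mem_preimage, Set.mem_pi, SetLike.mem_coe, Finset.mem_range]
    constructor
    · rintro ⟨h0, h⟩ (_ | i) hi
      · simpa using h0
      · exact h i (by omega)
    · intro h
      exact ⟨by simpa using h 0 (by omega), fun i hi => h (i + 1) (by omega)⟩
  rw [hset, ← Measure.map_apply (by fun_prop) (.pi (Finset.countable_toSet _) fun i _ => hmeas i),
    Measure.map_infinitePi_infinitePi_of_inj (P := fun _ : ℤ => G) hinj,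
    Measure.infinitePi_pi _ fun i _ => hmeas i, Finset.prod_range_succ', mul_comm]
  rfl

/-- Interval `past k` contributes its length through `f`; the `k` more recent ones contribute,
through `g`, the probability that their message is pushed out. -/
lemma lintegral_infinitePi_past {f g : ℝ → ENNReal} (hf : Measurable f) (hg : Measurable g)
    (k : ℕ) :
    ∫⁻ X, f (X (past k)) * ∏ i ∈ Finset.range k, g (X (past i))
      ∂(Measure.infinitePi fun _ : {n : ℤ // n ≠ 0} => F) =
      (∫⁻ x, f x ∂F) * (∫⁻ x, g x ∂F) ^ k := by
  have hmap := Measure.map_infinitePi_infinitePi_of_inj (P := fun _ : {n : ℤ // n ≠ 0} => F)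
    past_injective
  have hfg (i : ℕ) : Measurable (if i = k then f else g) := by split_ifs <;> assumption
  have h := lintegral_infinitePi_prod (P := F) (Finset.range (k + 1)) hfg
  have hne (i : ℕ) (hi : i ∈ Finset.range k) : i ≠ k := (Finset.mem_range.1 hi).ne
  have hprod : Measurable fun x : ℕ → ℝ =>
      ∏ i ∈ Finset.range (k + 1), (if i = k then f else g) (x i) :=
    Finset.measurable_fun_prod _ fun i _ => (hfg i).comp (measurable_pi_apply i)
  rw [← hmap, lintegral_map hprod (by fun_prop)] at h
  simp only [Finset.prod_range_succ, if_true] at h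
  rw [mul_comm (∫⁻ x, f x ∂F), ← Finset.card_range k, ← Finset.prod_const, Finset.card_range]
  rw [Finset.prod_congr rfl fun i hi => by rw [if_neg (hne i hi)]] at h
  rw [← h]
  refine lintegral_congr fun X => ?_
  rw [mul_comm]
  congr 1
  exact Finset.prod_congr rfl fun i hi => by rw [if_neg (hne i hi)]

/-- The mean relative age at time `0`. -/
lemma lintegral_Delta_zero (h : IsNondegenerate F G) (h0 : ∫⁻ x, ENNReal.ofReal x ∂F ≠ 0)
    (htop : ∫⁻ x, ENNReal.ofReal x ∂F ≠ ⊤) :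
    ∫⁻ ω, ENNReal.ofReal (Delta ω 0) ∂stationaryLaw F G =
      (∫⁻ x, (∫⁻ a in Set.Ico 0 x, G (Set.Ioi a)) ∂F) * (1 - ∫⁻ x, G (Set.Ici x) ∂F)⁻¹ := by
  have := isProbabilityMeasure_inspectionLaw h0 htop
  have hIoi : Measurable fun a => G (Set.Ioi a) :=
    Antitone.measurable fun a b hab => measure_mono (Set.Ioi_subset_Ioi hab)
  have hIci : Measurable fun a => G (Set.Ici a) :=
    Antitone.measurable fun a b hab => measure_mono (Set.Ici_subset_Ici.2 hab)
  let E (k : ℕ) : Set Sample := {ω | ω.1.2 < ω.2.2 0 ∧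
    ∀ i ∈ Finset.range k, ω.2.1 (past i) ≤ ω.2.2 (-(i + 1 : ℕ))}
  have hE (k : ℕ) : MeasurableSet (E k) := by
    have hEk : E k = {ω : Sample | ω.1.2 < ω.2.2 0} ∩ ⋂ i ∈ Finset.range k,
        {ω : Sample | ω.2.1 (past i) ≤ ω.2.2 (-(i + 1 : ℕ))} := by
      ext ω
      simp [E]
    rw [hEk]
    exact (measurableSet_lt (by fun_prop) (by fun_prop)).inter
      (.iInter fun i => .iInter fun _ => measurableSet_le (by fun_prop) (by fun_prop))
  have hf (k : ℕ) : Measurable ((E k).indicator fun ω => ENNReal.ofReal (ω.2.1 (past k))) :=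
    Measurable.indicator (by fun_prop) (hE k)
  have hsum : ∀ᵐ ω ∂stationaryLaw F G, ENNReal.ofReal (Delta ω 0) =
      ∑' k, (E k).indicator (fun ω => ENNReal.ofReal (ω.2.1 (past k))) ω := by
    filter_upwards [ae_isRegularPath h] with ω hω
    have harr0 : arrival ω 0 = -ω.1.2 := by simp [arrival]
    have harr1 : arrival ω 1 = -ω.1.2 + ω.1.1 := by
      simp [arrival, gap, show Finset.Ico (0 : ℤ) 1 = {0} from rfl]
    have := hω.1.ofReal_relAoI_zero (by linarith [hω.2.1]) (by linarith [hω.2.2])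
    rw [Delta, this]
    simp only [arrival_neg_sub, harr0, neg_neg]
    rfl
  have hterm (k : ℕ) : ∫⁻ ω, (E k).indicator (fun ω => ENNReal.ofReal (ω.2.1 (past k))) ω
      ∂stationaryLaw F G = (∫⁻ p, G (Set.Ioi p.2) ∂inspectionLaw F) *
        ((∫⁻ x, ENNReal.ofReal x ∂F) * (∫⁻ x, G (Set.Ici x) ∂F) ^ k) := by
    have hp : Measurable fun p : ℝ × ℝ => G (Set.Ioi p.2) := hIoi.comp measurable_snd
    rw [stationaryLaw, lintegral_prod _ (hf k).aemeasurable, ← lintegral_mul_const _ hp]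
    refine lintegral_congr fun p => ?_
    have hfp : Measurable fun q =>
        (E k).indicator (fun ω => ENNReal.ofReal (ω.2.1 (past k))) (p, q) :=
      (hf k).comp measurable_prodMk_left
    have hEp (X : {n : ℤ // n ≠ 0} → ℝ) : MeasurableSet {S : ℤ → ℝ | (p, X, S) ∈ E k} :=
      (hE k).preimage (measurable_prodMk_left.comp measurable_prodMk_left)
    rw [lintegral_prod _ hfp.aemeasurable,
      ← lintegral_infinitePi_past ENNReal.measurable_ofReal hIci k,
      ← lintegral_const_mul' _ _ (measure_ne_top _ _)]
    -- With age and gaps fixed, `E k` is a box in the service times, of product probability.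
    refine lintegral_congr fun X => ?_
    have hbox := infinitePi_past_box (G := G) _ (measurableSet_Ioi (a := p.2)) _
      (fun i => measurableSet_Ici (a := X (past i))) k
    rw [mul_left_comm, ← hbox, ← lintegral_indicator_const]
    · rfl
    · exact hEp X
  rw [lintegral_congr_ae hsum, lintegral_tsum fun k => (hf k).aemeasurable]
  simp only [hterm]
  rw [ENNReal.tsum_mul_left, ENNReal.tsum_mul_left, ENNReal.tsum_geometric,
    lintegral_inspectionLaw hIoi, ← mul_assoc, mul_right_comm _ _ (∫⁻ x, ENNReal.ofReal x ∂F),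
    ENNReal.inv_mul_cancel h0 htop, one_mul]

/-! ### Exponential laws -/

section Exponential

variable {r : ℝ}

lemma expMeasure_Iic (hr : 0 < r) {x : ℝ} (hx : 0 ≤ x) :
    expMeasure r (Set.Iic x) = ENNReal.ofReal (1 - Real.exp (-(r * x))) := by
  rw [expMeasure, gammaMeasure, withDensity_apply _ measurableSet_Iic]
  exact (lintegral_exponentialPDF_eq_antiDeriv hr x).trans (by rw [if_pos hx])

lemma expMeasure_Ioi (hr : 0 < r) {x : ℝ} (hx : 0 ≤ x) :
    expMeasure r (Set.Ioi x) = ENNReal.ofReal (Real.exp (-(r * x))) := by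
  have := isProbabilityMeasure_expMeasure hr
  have hle : Real.exp (-(r * x)) ≤ 1 := Real.exp_le_one_iff.2 (by nlinarith)
  rw [← Set.compl_Iic, prob_compl_eq_one_sub measurableSet_Iic, expMeasure_Iic hr hx,
    ← ENNReal.ofReal_one, ← ENNReal.ofReal_sub _ (by linarith), sub_sub_cancel]

lemma ae_expMeasure_pos (hr : 0 < r) : ∀ᵐ x ∂expMeasure r, 0 < x := by
  rw [ae_iff]
  have h := expMeasure_Iic hr le_rfl
  rw [mul_zero, neg_zero, Real.exp_zero, sub_self, ENNReal.ofReal_zero] at h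
  simpa [Set.Iic] using h

/-- The constant hazard rate: the density at `a ≥ 0` is `r` times the tail beyond `a`. -/
lemma setLIntegral_expMeasure_Ioi (hr : 0 < r) {s : Set ℝ} (hs : MeasurableSet s)
    (hpos : ∀ x ∈ s, 0 ≤ x) :
    ∫⁻ a in s, expMeasure r (Set.Ioi a) = (ENNReal.ofReal r)⁻¹ * expMeasure r s := by
  have hr0 : ENNReal.ofReal r ≠ 0 := by simpa using hr
  have h : expMeasure r s = ENNReal.ofReal r * ∫⁻ a in s, expMeasure r (Set.Ioi a) := by
    have hd : expMeasure r s = ∫⁻ a in s, exponentialPDF r a := withDensity_apply _ hs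
    rw [hd, ← lintegral_const_mul' _ _ ENNReal.ofReal_ne_top]
    refine setLIntegral_congr_fun hs fun a ha => ?_
    rw [expMeasure_Ioi hr (hpos a ha), ← ENNReal.ofReal_mul hr.le]
    exact exponentialPDF_of_nonneg (hpos a ha)
  rw [h, ← mul_assoc, ENNReal.inv_mul_cancel hr0 ENNReal.ofReal_ne_top, one_mul]

lemma lintegral_ofReal_expMeasure_ne_top (hr : 0 < r) :
    ∫⁻ x, ENNReal.ofReal x ∂expMeasure r ≠ ⊤ := by
  have := isProbabilityMeasure_expMeasure hr
  -- The mean is the integral of the tail, to which the hazard-rate identity applies on `Ioi 0`.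
  rw [lintegral_eq_lintegral_meas_lt _ ((ae_expMeasure_pos hr).mono fun x hx => hx.le)
    aemeasurable_id']
  change ∫⁻ t in Set.Ioi 0, expMeasure r (Set.Ioi t) ≠ ⊤
  rw [setLIntegral_expMeasure_Ioi hr measurableSet_Ioi fun x hx => (Set.mem_Ioi.1 hx).le]
  exact ENNReal.mul_ne_top (ENNReal.inv_ne_top.2 (by simpa using hr)) (measure_ne_top _ _)

end Exponential

/-! ### The GI/M/1/1-PO server -/

/-- With exponential service times of rate `δ`, the stationary average relative age is `1 / δ`
whatever the interarrival law. -/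
theorem hasStationaryAverage_expMeasure {F : Measure ℝ} [IsProbabilityMeasure F] {δ : ℝ}
    (hδ : 0 < δ) (hpos : ∀ᵐ x ∂F, 0 < x) (htop : ∫⁻ x, ENNReal.ofReal x ∂F ≠ ⊤)
    {c : ℝ} (hc : 0 < c) (hFc : F (Set.Ioi c) ≠ 0) :
    HasStationaryAverage F (expMeasure δ) (1 / δ) := by
  have := isProbabilityMeasure_expMeasure hδ
  set G := expMeasure δ with hG
  have hGpos : ∀ᵐ s ∂G, 0 < s := ae_expMeasure_pos hδ
  have hGIio {x : ℝ} (hx : 0 < x) : G (Set.Iio x) ≠ 0 := by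
    intro h0
    have h1 : G (Set.Iic (x / 2)) = 0 :=
      measure_mono_null (Set.Iic_subset_Iio.2 (by linarith)) h0
    rw [hG, expMeasure_Iic hδ (by positivity), ENNReal.ofReal_eq_zero, sub_nonpos,
      Real.one_le_exp_iff] at h1
    nlinarith
  have hnd : IsNondegenerate F G :=
    ⟨hpos, hGpos.mono fun s hs => hs.le, c, hc, hFc, hGIio hc⟩
  have hne_zero : ∀ {f : ℝ → ENNReal}, Measurable f → (∀ x, 0 < x → f x ≠ 0) →
      ∫⁻ x, f x ∂F ≠ 0 := by
    intro f hf hf0 h0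
    rw [lintegral_eq_zero_iff hf] at h0
    obtain ⟨x, hx, hx0⟩ := (hpos.and h0).exists
    exact hf0 x hx hx0
  have hmean : ∫⁻ x, ENNReal.ofReal x ∂F ≠ 0 :=
    hne_zero ENNReal.measurable_ofReal fun x hx => by simpa using hx
  have hprob := isProbabilityMeasure_inspectionLaw hmean htop
  have hIci : Measurable fun a => G (Set.Ici a) :=
    Antitone.measurable fun a b hab => measure_mono (Set.Ici_subset_Ici.2 hab)
  have hIio : Measurable fun a => G (Set.Iio a) :=
    Monotone.measurable fun a b hab => measure_mono (Set.Iio_subset_Iio hab)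
  have hcompl : 1 - ∫⁻ x, G (Set.Ici x) ∂F = ∫⁻ x, G (Set.Iio x) ∂F := by
    have hsum : ∫⁻ x, G (Set.Iio x) ∂F + ∫⁻ x, G (Set.Ici x) ∂F = 1 := by
      rw [← lintegral_add_left hIio]
      simp_rw [← Set.compl_Iio, prob_add_prob_compl measurableSet_Iio]
      simp
    refine ENNReal.sub_eq_of_eq_add (fun h => ?_) hsum.symm
    rw [h, add_top] at hsum
    exact ENNReal.top_ne_one hsum
  -- The numerator is the success probability divided by `δ`, and that probability is also the
  -- denominator. `Ico 0 x` and `Iio x` agree up to a `G`-null set.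
  have hIco : ∫⁻ x, (∫⁻ a in Set.Ico 0 x, G (Set.Ioi a)) ∂F =
      (ENNReal.ofReal δ)⁻¹ * ∫⁻ x, G (Set.Iio x) ∂F := by
    rw [← lintegral_const_mul _ hIio]
    refine lintegral_congr fun x => ?_
    rw [setLIntegral_expMeasure_Ioi hδ measurableSet_Ico fun a ha => ha.1]
    congr 1
    refine measure_congr ?_
    filter_upwards [hGpos] with s hs
    exact propext ⟨fun h => h.2, fun h => ⟨hs.le, h⟩⟩
  have hzero : ∫⁻ ω, ENNReal.ofReal (Delta ω 0) ∂stationaryLaw F G = ENNReal.ofReal (1 / δ) := by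
    rw [lintegral_Delta_zero hnd hmean htop, hcompl, hIco, mul_assoc, ENNReal.mul_inv_cancel
      (hne_zero hIio fun x hx => hGIio hx), mul_one, one_div, ENNReal.ofReal_inv_of_pos hδ]
    rw [← hcompl]
    exact ENNReal.sub_ne_top ENNReal.one_ne_top
  have hstat := identDistrib_Delta hnd
  have hat (t : ℝ) : IdentDistrib (fun ω => Delta ω t) (fun ω => Delta ω 0)
      (stationaryLaw F G) (stationaryLaw F G) := by
    simpa [Function.comp_def] using (hstat t).comp (measurable_pi_apply (0 : ℝ))
  have hnonneg : 0 ≤ᵐ[stationaryLaw F G] fun ω => Delta ω 0 := by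
    filter_upwards [ae_isRegularPath hnd] with ω hω
    exact hω.1.relAoI_nonneg 0
  have hmeas : AEStronglyMeasurable (fun ω => Delta ω 0) (stationaryLaw F G) :=
    (hat 0).aemeasurable_fst.aestronglyMeasurable
  refine ⟨inferInstanceAs (IsProbabilityMeasure ((inspectionLaw F).prod _)), hstat, fun t => ?_,
    fun t => ?_⟩
  · rw [(hat t).integrable_iff]
    refine ⟨hmeas, ?_⟩
    rw [hasFiniteIntegral_iff_ofReal hnonneg, hzero]
    exact ENNReal.ofReal_lt_top
  · rw [(hat t).integral_eq, integral_eq_lintegral_of_nonneg_ae hnonneg hmeas, hzero,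
      ENNReal.toReal_ofReal (by positivity)]

end PushOut

theorem corollary3 (β δ : ℝ) (hβ : 0 < β) (hδ : 0 < δ) :
    PushOut.HasStationaryAverage (expMeasure β) (expMeasure δ) (1 / δ) ∧
      PushOut.HasStationaryAverage (Measure.dirac (1 / β)) (expMeasure δ) (1 / δ) := by
  constructor
  · have := isProbabilityMeasure_expMeasure hβ
    refine PushOut.hasStationaryAverage_expMeasure hδ (PushOut.ae_expMeasure_pos hβ)
      (PushOut.lintegral_ofReal_expMeasure_ne_top hβ) one_pos ?_
    rw [PushOut.expMeasure_Ioi hβ zero_le_one]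
    simpa using Real.exp_pos _
  -- Any level strictly between `0` and the constant gap `1 / β` would do.
  · refine PushOut.hasStationaryAverage_expMeasure hδ (c := 1 / β / 2) ?_ ?_ (by positivity) ?_
    · rw [ae_dirac_iff measurableSet_Ioi]
      positivity
    · simp
    · have : 1 / β / 2 < 1 / β := half_lt_self (by positivity)
      rw [Measure.dirac_apply' _ measurableSet_Ioi, Set.indicator_of_mem (Set.mem_Ioi.2 this)]
      simp
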